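/- Let $M\ge 1$, let $\Omega=\{\Omega_1<\dots<\Omega_L\}\subseteq\{1,\dots,M\}$ be a nonempty set of sampling times ($L=M$ is allowed), let $\overline M=\Omega_L-\Omega_1+1$, and let $y_\Omega\in\mathbb C^{\Omega}$ be any data vector. For $f\in\mathbb R$ let $a_\Omega(f)=(e^{i2\pi(j-1)f})_{j\in\Omega}$. For $u\in\mathbb C^M$ let $T(u)\in\mathbb C^{M\times M}$ be the Toeplitz matrix with $(j,k)$ entry $u_{k-j+1}$ for $j\le k$ and $\overline{u_{j-k+1}}$ for $j>k$, and let $T(u)_\Omega$ be its submatrix with rows and columns in $\Omega$. For a positive semidefinite matrix $R\in\mathbb C^{\Omega\times\Omega}$ put $$h(R)=\operatorname{tr}(R)+\|y_\Omega\|_2^2\; y_\Omega^HR^{-1}y_\Omega ,$$ where $y_\Omega^HR^{-1}y_\Omega$ denotes the least real $x$ such that $\begin{bmatrix}x&y_\Omega^H\\ y_\Omega&R\end{bmatrix}$ is positive semidefinite (the usual value if $R$ is invertible), and $+\infty$ if there is no such $x$. Let $\Sigma\subseteq[0,\infty)^{\Omega}$ be the set of noise variance vectors allowed by one of the following three noise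 assumptions: heteroscedastic noise, $\Sigma=[0,\infty)^{\Omega}$; homoscedastic noise, $\Sigma=\{(s,\dots,s): s\ge0\}$; homoscedastic noise with known variance $\sigma_0>0$, $\Sigma=\{(\sigma_0,\dots,\sigma_0)\}$. Define the optimal values of gridless SPICE (GLS) and, for $N\ge1$, of SPICE on the uniform frequency grid of $N$ points by $$\mathrm{GLS}^*=\inf\bigl\{h\bigl(T(u)_\Omega+\operatorname{diag}(\sigma)\bigr): u\in\mathbb C^M,\ T(u)\succeq0,\ \sigma\in\Sigma\bigr\},$$ $$\mathrm{SPICE}_N^*=\inf\Bigl\{h\Bigl(\sum_{l=0}^{N-1}p_l\,a_\Omega(l/N)\,a_\Omega(l/N)^H+\operatorname{diag}(\sigma)\Bigr): p\in[0,\infty)^N,\ \sigma\in\Sigma\Bigr\}.$$ Then, under each of the three noise assumptions, $\mathrm{GLS}^*$ and $\mathrm{SPICE}_N^*$ ($N\ge1$) are finite, and for every $N\ge 1$ $$\Bigl(1-\frac{\pi\overline M}{N}\Bigr)\mathrm{SPICE}_N^*\;\le\;\mathrm{GLS}^*\;\le\;\mathrm{SPICE}_N^* .$$ Consequently $\mathrm{SPICE}_N^*\to\mathrm{GLS}^*$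 as $N\to\infty$. -/

import Mathlib

open scoped ComplexOrder

noncomputable section

namespace LineSpectral

/-- The Hermitian Toeplitz matrix `T(u)` with first row `u` (zero-based indices): the entry `(j, k)`
is `u (k - j)` on and above the diagonal and the conjugate of `u (j - k)` below it. -/
def toeplitz {M : ℕ} (u : Fin M → ℂ) : Matrix (Fin M) (Fin M) ℂ :=
  Matrix.of fun j k =>
    if j ≤ k then u ⟨k.val - j.val, by omega⟩ else star (u ⟨j.val - k.val, by omega⟩)

/-- The matrix `A_Ω(f)`: its column `l` holds the samples at the times in `Ω` of the complex
sinusoid of frequency `f l`. The sampling times are zero-based. -/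
def steering {M : ℕ} (Ω : Finset (Fin M)) {K : ℕ} (f : Fin K → ℝ) : Matrix Ω (Fin K) ℂ :=
  Matrix.of fun j l =>
    Complex.exp (2 * (Real.pi : ℂ) * Complex.I * ((j : Fin M).val : ℂ) * (f l : ℂ))

/-- The uniform grid `0, 1/N, …, (N-1)/N`. -/
def uniformGrid (N : ℕ) : Fin N → ℝ := fun l => (l.val : ℝ) / (N : ℝ)

/-- The diagonal covariance matrix of the noise with variances `σ`. -/
def noiseCov {ι : Type*} [DecidableEq ι] (σ : ι → ℝ) : Matrix ι ι ℂ :=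
  Matrix.diagonal fun j => (σ j : ℂ)

/-- The covariance matrix `Γ_Ω T(u) Γ_Ωᵀ + diag σ` of the observed samples. -/
def toeplitzCov {M : ℕ} (Ω : Finset (Fin M)) (u : Fin M → ℂ) (σ : Ω → ℝ) : Matrix Ω Ω ℂ :=
  (toeplitz u).submatrix Subtype.val Subtype.val + noiseCov σ

/-- The covariance matrix `A_Ω(f) diag(p) A_Ω(f)ᴴ + diag σ` of the observed samples. -/
def sinusoidCov {M : ℕ} (Ω : Finset (Fin M)) {K : ℕ} (f : Fin K → ℝ) (p : Fin K → ℝ)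
    (σ : Ω → ℝ) : Matrix Ω Ω ℂ :=
  steering Ω f * Matrix.diagonal (fun l => (p l : ℂ)) * (steering Ω f).conjTranspose + noiseCov σ

/-- The Hermitian block matrix with rows `[x, yᴴ]` and `[y, R]`. -/
def bordered {ι : Type*} (x : ℝ) (y : ι → ℂ) (R : Matrix ι ι ℂ) :
    Matrix (Unit ⊕ ι) (Unit ⊕ ι) ℂ :=
  Matrix.fromBlocks (Matrix.of fun _ _ => (x : ℂ)) (Matrix.replicateRow Unit (star y))
    (Matrix.replicateCol Unit y) R

/-- The value `yᴴ R⁻¹ y` of a positive semidefinite, possibly singular `R`: the least `x` for which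
the bordered matrix is positive semidefinite, and `+∞` if there is none, that is, if `y` is not in
the range of `R`. -/
def invQuadForm {ι : Type*} (R : Matrix ι ι ℂ) (y : ι → ℂ) : EReal :=
  ⨅ (x : ℝ) (_ : (bordered x y R).PosSemidef), (x : EReal)

/-- The weighted covariance fitting objective `tr R + ‖y‖₂² yᴴ R⁻¹ y`. -/
def wcfObjective {ι : Type*} [Fintype ι] (R : Matrix ι ι ℂ) (y : ι → ℂ) : EReal :=
  ((R.trace.re : ℝ) : EReal) + ((∑ j, ‖y j‖ ^ 2 : ℝ) : EReal) * invQuadForm R y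

/-- The assumptions on the noise: arbitrary unknown variances, equal unknown variances, or equal
variances with a known value `σ₀ > 0`. -/
inductive NoiseModel : Type
  | heteroscedastic : NoiseModel
  | homoscedastic : NoiseModel
  | homoscedasticKnown (σ₀ : ℝ) (hσ₀ : 0 < σ₀) : NoiseModel

/-- The noise variance vectors that a noise model allows. -/
def NoiseModel.variances (ι : Type*) : NoiseModel → Set (ι → ℝ)
  | .heteroscedastic => {σ | ∀ j, 0 ≤ σ j}
  | .homoscedastic => {σ | ∃ s : ℝ, 0 ≤ s ∧ ∀ j, σ j = s}
  | .homoscedasticKnown σ₀ _ => {σ | ∀ j, σ j = σ₀}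

/-- The optimal value of gridless SPICE (GLS). -/
def glsOpt {M : ℕ} (Ω : Finset (Fin M)) (noise : NoiseModel) (y : Ω → ℂ) : EReal :=
  ⨅ (u : Fin M → ℂ) (_ : (toeplitz u).PosSemidef) (σ : Ω → ℝ) (_ : σ ∈ noise.variances Ω),
    wcfObjective (toeplitzCov Ω u σ) y

/-- The optimal value of SPICE with the frequencies on the uniform grid of `N` points. -/
def spiceOpt {M : ℕ} (Ω : Finset (Fin M)) (noise : NoiseModel) (y : Ω → ℂ) (N : ℕ) : EReal :=
  ⨅ (p : Fin N → ℝ) (_ : ∀ l, 0 ≤ p l) (σ : Ω → ℝ) (_ : σ ∈ noise.variances Ω),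
    wcfObjective (sinusoidCov Ω (uniformGrid N) p σ) y

/-- The range of the sampling period: last minus first sampling time, plus one. -/
def samplingRange {M : ℕ} (Ω : Finset (Fin M)) (hΩ : Ω.Nonempty) : ℕ :=
  (Ω.max' hΩ).val - (Ω.min' hΩ).val + 1

end LineSpectral

end

/-! The upper bound on the gridless value holds because every grid covariance is a compressed
positive semidefinite Toeplitz matrix plus noise (`exists_posSemidef_toeplitz`).

For the lower bound, Carathéodory–Fejér (`exists_toeplitz_eq_sum`) writes a feasible Toeplitz
covariance as `∑ p_k a(f_k) a(f_k)ᴴ`. Each off-grid `a(f_k)` is a combination `∑ c_kl a(l/N)` with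
`∑_l |c_kl| ≤ C = exp (π (M̄ - 1) / N)`. By Cauchy–Schwarz, the grid powers `q_l = ∑_k p_k |c_kl|`
give a covariance `R'` with `R ≤ C R'` in the Loewner order and `tr R' ≤ C tr R`. The first
inequality controls `yᴴ R'⁻¹ y` by `C yᴴ R⁻¹ y`, so the whole objective grows by a factor of at most
`C`. Finally `1 - x ≤ exp (-x)`.

The coefficients come from a discrete Bernstein inequality (`norm_fejerMatrix_le`). A matrix of
`ℓ^∞` operator norm at most `D` acts as differentiation on the sampled exponentials of frequency `0,
…, D`. Its exponential therefore translates from the nearest grid point to `f`, and the entries of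
one of its rows are the coefficients. -/

open scoped ComplexOrder

noncomputable section

namespace LineSpectral

open Finset

/-! ### Interpolation from the grid by exponentiating a Fejér-type differentiation matrix -/

section Interpolation

open ZMod

variable {N : ℕ} [NeZero N]

lemma sum_stdAddChar_mul (k : ZMod N) :
    ∑ b : ZMod N, stdAddChar (b * k) = if k = 0 then (N : ℂ) else 0 := by
  have := AddChar.sum_mulShift (R := ZMod N) (ψ := stdAddChar) k (isPrimitive_stdAddChar N)
  simpa using this

/-- The circulant matrix on the grid that multiplies the exponential sequence of frequency `t` by
`t`, for `0 ≤ t ≤ D`: convolution with a modulated Fejér kernel. -/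
def fejerMatrix (N : ℕ) [NeZero N] (D : ℕ) : Matrix (ZMod N) (ZMod N) ℂ :=
  Matrix.of fun a b => (N : ℂ)⁻¹ * ∑ i ∈ range D, ∑ j ∈ range D,
    stdAddChar ((a - b) * ((D : ZMod N) + (i : ZMod N) - (j : ZMod N)))

/-- Orthogonality of characters leaves only the pairs `(i, j)` with `D + i - j = t`. There are `D -
|t - D| = t` of them: on `0 ≤ t ≤ D` the triangular Fejér weights centred at `D` coincide with the
identity function. -/
lemma fejerMatrix_mulVec (D t : ℕ) (hD : 2 * D ≤ N) (ht : t ≤ D) :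
    (fejerMatrix N D).mulVec (fun b => stdAddChar (b * (t : ZMod N))) =
      (t : ℂ) • fun a => stdAddChar (a * (t : ZMod N)) := by
  have hN : (N : ℂ) ≠ 0 := NeZero.ne _
  ext a
  simp only [Matrix.mulVec, dotProduct, fejerMatrix, Matrix.of_apply, Pi.smul_apply, smul_eq_mul]
  have h1 : ∀ b : ZMod N, (N : ℂ)⁻¹ * (∑ i ∈ range D, ∑ j ∈ range D,
      stdAddChar ((a - b) * ((D : ZMod N) + (i : ZMod N) - (j : ZMod N)))) * stdAddChar (b * (t : ZMod N)) =
      ∑ i ∈ range D, ∑ j ∈ range D, (N : ℂ)⁻¹ * (stdAddChar (a * ((D : ZMod N) + (i : ZMod N) - (j : ZMod N))) *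
        stdAddChar (b * ((t : ZMod N) - ((D : ZMod N) + (i : ZMod N) - (j : ZMod N))))) := by
    intro b
    rw [mul_sum, sum_mul]
    refine sum_congr rfl fun i _ => ?_
    rw [mul_sum, sum_mul]
    refine sum_congr rfl fun j _ => ?_
    rw [mul_assoc, ← AddChar.map_add_eq_mul, ← AddChar.map_add_eq_mul]
    congr 2
    ring
  simp_rw [h1]
  rw [sum_comm]
  have h2 : ∀ i ∈ range D, (∑ b : ZMod N, ∑ j ∈ range D, (N : ℂ)⁻¹ *
      (stdAddChar (a * ((D : ZMod N) + (i : ZMod N) - (j : ZMod N))) *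
        stdAddChar (b * ((t : ZMod N) - ((D : ZMod N) + (i : ZMod N) - (j : ZMod N)))))) =
      if i < t then stdAddChar (a * (t : ZMod N)) else 0 := by
    intro i hi
    rw [mem_range] at hi
    rw [sum_comm]
    have h3 : ∀ j ∈ range D, (∑ b : ZMod N, (N : ℂ)⁻¹ *
        (stdAddChar (a * ((D : ZMod N) + (i : ZMod N) - (j : ZMod N))) *
        stdAddChar (b * ((t : ZMod N) - ((D : ZMod N) + (i : ZMod N) - (j : ZMod N)))))) =
        if j = D + i - t then stdAddChar (a * (t : ZMod N)) else 0 := by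
      intro j hj
      rw [mem_range] at hj
      rw [← mul_sum, ← mul_sum, sum_stdAddChar_mul]
      -- No aliasing: the integer `t - (D + i - j)` has absolute value below `2 * D ≤ N`. The
      -- natural subtraction on the right never truncates, as `t ≤ D`.
      have h4 : (t : ZMod N) - ((D : ZMod N) + (i : ZMod N) - (j : ZMod N)) = 0 ↔ j = D + i - t := by
        have h5 : (t : ZMod N) - ((D : ZMod N) + (i : ZMod N) - (j : ZMod N)) = ((t - (D + i - j) : ℤ) : ZMod N) := by
          push_cast; ring
        rw [h5, ZMod.intCast_zmod_eq_zero_iff_dvd]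
        constructor
        · intro h
          have := Int.eq_zero_of_abs_lt_dvd h (by rw [abs_lt]; omega)
          omega
        · intro h
          have : (t - (D + i - j) : ℤ) = 0 := by omega
          rw [this]; exact dvd_zero _
      by_cases h : j = D + i - t
      · have h' := h4.2 h
        rw [if_pos h', if_pos h, ← sub_eq_zero.1 h']
        field_simp
      · rw [if_neg (mt h4.1 h), if_neg h]; simp
    rw [sum_congr rfl h3, sum_ite_eq']
    refine if_congr ?_ rfl rfl
    rw [mem_range]; omega
  rw [sum_congr rfl h2, ← sum_filter, sum_const, nsmul_eq_mul]
  congr 2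
  have : (range D).filter (· < t) = range t := by
    ext x; simp only [mem_filter, mem_range]; omega
  rw [this, card_range]

lemma norm_stdAddChar_eq_one (x : ZMod N) : ‖(stdAddChar x : ℂ)‖ = 1 := by
  rw [stdAddChar_apply]; exact Circle.norm_coe _

/-- Up to a unimodular modulation, the entry is a Fejér kernel `s * conj s`, which is nonnegative.
Taking norms just removes the shift by `D`, so row sums of norms become sums of characters. -/
lemma norm_fejerMatrix_apply (D : ℕ) (a b : ZMod N) :
    ((‖fejerMatrix N D a b‖ : ℝ) : ℂ) = (N : ℂ)⁻¹ * ∑ i ∈ range D, ∑ j ∈ range D,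
      stdAddChar ((a - b) * ((i : ZMod N) - (j : ZMod N))) := by
  set s : ℂ := ∑ i ∈ range D, stdAddChar ((a - b) * (i : ZMod N)) with hs
  have h0 : ∀ x : ZMod N, (starRingEnd ℂ) (stdAddChar x : ℂ) = stdAddChar (-x) := fun x =>
    (AddChar.map_neg_eq_conj _ x).symm
  have h1 : ∑ i ∈ range D, ∑ j ∈ range D, (stdAddChar ((a - b) * ((i : ZMod N) - (j : ZMod N))) : ℂ) =
      s * (starRingEnd ℂ) s := by
    rw [hs, map_sum, sum_mul_sum]
    refine sum_congr rfl fun i _ => sum_congr rfl fun j _ => ?_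
    rw [h0, ← AddChar.map_add_eq_mul]
    congr 1; ring
  have h2 : fejerMatrix N D a b = (N : ℂ)⁻¹ *
      (stdAddChar ((a - b) * (D : ZMod N)) * (s * (starRingEnd ℂ) s)) := by
    rw [← h1, fejerMatrix, Matrix.of_apply]
    congr 1
    rw [mul_sum]
    refine sum_congr rfl fun i _ => ?_
    rw [mul_sum]
    refine sum_congr rfl fun j _ => ?_
    rw [← AddChar.map_add_eq_mul]
    congr 1; ring
  rw [h1, h2, Complex.mul_conj, norm_mul, norm_mul, norm_stdAddChar_eq_one]
  simp [Complex.normSq_nonneg]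

open scoped Matrix.Norms.Operator

/-- Summing the nonnegative kernel over a row keeps only its zero frequency, that is, the `D` pairs
`i = j`. -/
lemma norm_fejerMatrix_le (D : ℕ) (hD : D ≤ N) : ‖fejerMatrix N D‖ ≤ D := by
  have hN : (N : ℂ) ≠ 0 := NeZero.ne _
  have key : ∀ a : ZMod N, ∑ b, ‖fejerMatrix N D a b‖ = D := by
    intro a
    apply Complex.ofReal_injective
    rw [Complex.ofReal_sum]
    simp_rw [norm_fejerMatrix_apply]
    rw [← mul_sum, sum_comm]
    have h2 : ∀ i ∈ range D, (∑ b : ZMod N, ∑ j ∈ range D,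
        (stdAddChar ((a - b) * ((i : ZMod N) - (j : ZMod N))) : ℂ)) = N := by
      intro i hi
      rw [mem_range] at hi
      rw [sum_comm]
      have h3 : ∀ j ∈ range D, (∑ b : ZMod N,
          (stdAddChar ((a - b) * ((i : ZMod N) - (j : ZMod N))) : ℂ)) = if j = i then (N : ℂ) else 0 := by
        intro j hj
        rw [mem_range] at hj
        have := (Equiv.subLeft a).sum_comp
          fun b => (stdAddChar (b * ((i : ZMod N) - (j : ZMod N))) : ℂ)
        simp only [Equiv.subLeft_apply] at this
        rw [this, sum_stdAddChar_mul]
        refine if_congr ?_ rfl rfl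
        rw [sub_eq_zero, ZMod.natCast_eq_natCast_iff', Nat.mod_eq_of_lt (by omega),
          Nat.mod_eq_of_lt (by omega), eq_comm]
      rw [sum_congr rfl h3, sum_ite_eq', if_pos (mem_range.2 hi)]
    rw [sum_congr rfl h2]
    simp
    field_simp
  rw [Matrix.linfty_opNorm_def, ← NNReal.coe_natCast, NNReal.coe_le_coe]
  refine Finset.sup_le fun a _ => ?_
  rw [← NNReal.coe_le_coe]
  push_cast
  exact (key a).le

lemma exp_mulVec_of_mulVec_eq {ι : Type*} [Fintype ι] [DecidableEq ι] (A : Matrix ι ι ℂ)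
    (v : ι → ℂ) (μ : ℂ) (h : A.mulVec v = μ • v) :
    (NormedSpace.exp A).mulVec v = Complex.exp μ • v := by
  have hpow : ∀ n : ℕ, (A ^ n).mulVec v = μ ^ n • v := by
    intro n
    induction n with
    | zero => simp
    | succ n ih =>
      rw [pow_succ, ← Matrix.mulVec_mulVec, h, Matrix.mulVec_smul, ih, smul_smul, pow_succ,
        mul_comm]
  have h1 := (NormedSpace.exp_series_hasSum_exp' (𝕂 := ℂ) A)
  have h2 := (NormedSpace.exp_series_hasSum_exp' (𝕂 := ℂ) μ)
  rw [← Complex.exp_eq_exp_ℂ] at h2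
  have h3 := h1.map (AddMonoidHom.mk' (fun B : Matrix ι ι ℂ => B.mulVec v)
    fun B C => Matrix.add_mulVec B C v) (by
      show Continuous (fun B : Matrix ι ι ℂ => B.mulVec v)
      fun_prop)
  have h4 := h2.smul_const v
  refine h3.unique ?_
  convert h4 using 2 with n
  simp [Matrix.smul_mulVec, hpow, smul_smul]

lemma norm_exp_matrix_le {ι : Type*} [Fintype ι] [DecidableEq ι] [Nonempty ι]
    (A : Matrix ι ι ℂ) : ‖NormedSpace.exp A‖ ≤ Real.exp ‖A‖ := by
  have h1 := (NormedSpace.exp_series_hasSum_exp' (𝕂 := ℂ) A)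
  have h2 := (NormedSpace.exp_series_hasSum_exp' (𝕂 := ℝ) ‖A‖)
  rw [← Real.exp_eq_exp_ℝ] at h2
  refine h1.norm_le_of_bounded h2 fun n => ?_
  rw [norm_smul, smul_eq_mul]
  gcongr
  · simp
  · exact norm_pow_le A n

lemma sum_norm_row_le {ι : Type*} [Fintype ι] [DecidableEq ι] (A : Matrix ι ι ℂ) (a : ι) :
    ∑ b, ‖A a b‖ ≤ ‖A‖ := by
  rw [Matrix.linfty_opNorm_def]
  have := Finset.le_sup (f := fun i => ∑ j, ‖A i j‖₊) (mem_univ a)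
  have := NNReal.coe_le_coe.2 this
  push_cast at this
  exact this

/-- An exponential sequence of length `D + 1` is a combination of those with frequencies on the
grid of `N` points, with coefficients of `ℓ¹` norm at most `exp (π D / N)`. -/
lemma exists_grid_coefficients (D : ℕ) (hD : 2 * D ≤ N) (f : ℝ) :
    ∃ c : Fin N → ℂ, ∑ l, ‖c l‖ ≤ Real.exp (Real.pi * D / N) ∧
      ∀ t ≤ D, Complex.exp (2 * (Real.pi : ℂ) * Complex.I * (t : ℂ) * (f : ℂ)) =
        ∑ l, c l * Complex.exp (2 * (Real.pi : ℂ) * Complex.I * (t : ℂ) *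
          (uniformGrid N l : ℂ)) := by
  have hN : (N : ℂ) ≠ 0 := NeZero.ne _
  have hNpos : (0 : ℝ) < N := Nat.cast_pos.2 (Nat.pos_of_ne_zero (NeZero.ne N))
  -- The nearest grid point is `m / N`. Nothing requires `0 ≤ m < N`, since the grid exponentials
  -- depend only on `m` modulo `N`.
  set m : ℤ := round (N * f) with hm
  set δ : ℝ := f - m / N with hδ
  have hδle : |δ| ≤ 1 / (2 * N) := by
    have h1 : |(N : ℝ) * f - m| ≤ 1 / 2 := abs_sub_round _
    have h2 : δ = (N * f - m) / N := by rw [hδ]; field_simp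
    rw [h2, abs_div, abs_of_pos hNpos, div_le_iff₀ hNpos]
    refine h1.trans (le_of_eq ?_)
    field_simp
  set z : ℂ := 2 * Real.pi * Complex.I * δ with hz
  -- `E` multiplies the exponential of frequency `t ≤ D` by `exp (2πi δ t)`, a translation by `δ`.
  -- Row `m` of `E` thus evaluates at `m / N + δ = f`.
  set E : Matrix (ZMod N) (ZMod N) ℂ := NormedSpace.exp (z • fejerMatrix N D) with hE
  have hnz : ‖z‖ = 2 * Real.pi * |δ| := by
    rw [hz]; simp [abs_of_pos Real.pi_pos]
  have hnorm : ∑ b, ‖E (m : ZMod N) b‖ ≤ Real.exp (Real.pi * D / N) := by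
    refine (sum_norm_row_le E _).trans ((norm_exp_matrix_le _).trans (Real.exp_le_exp.2 ?_))
    rw [norm_smul, hnz]
    calc 2 * Real.pi * |δ| * ‖fejerMatrix N D‖
        ≤ 2 * Real.pi * (1 / (2 * N)) * D := by
          have := norm_fejerMatrix_le (N := N) D (by omega)
          have := Real.pi_pos
          gcongr
      _ = Real.pi * D / N := by field_simp
  have hval : ∀ t ≤ D, Complex.exp (2 * (Real.pi : ℂ) * Complex.I * (t : ℂ) * (f : ℂ)) =
      ∑ b, E (m : ZMod N) b * stdAddChar (b * (t : ZMod N)) := by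
    intro t ht
    have h1 := exp_mulVec_of_mulVec_eq (z • fejerMatrix N D)
      (fun b => (stdAddChar (b * (t : ZMod N)) : ℂ)) (z * t) (by
        rw [Matrix.smul_mulVec, fejerMatrix_mulVec D t hD ht, smul_smul])
    have h2 := congrFun h1 (m : ZMod N)
    simp only [Matrix.mulVec, dotProduct, Pi.smul_apply, smul_eq_mul] at h2
    rw [hE, h2]
    have h3 : ((m : ZMod N) * (t : ZMod N)) = ((m * t : ℤ) : ZMod N) := by push_cast; rfl
    rw [h3, stdAddChar_coe, ← Complex.exp_add, hz, hδ]
    congr 1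
    push_cast
    field_simp
    ring
  have hsum : ∀ {α : Type} [AddCommMonoid α] (F : ZMod N → α),
      ∑ l : Fin N, F ((l : ℕ) : ZMod N) = ∑ b, F b := by
    intro α _ F
    refine Function.Bijective.sum_comp (e := fun l : Fin N => ((l : ℕ) : ZMod N)) ?_ F
    rw [Fintype.bijective_iff_injective_and_card]
    refine ⟨fun x y h => ?_, by simp⟩
    have h' := (ZMod.natCast_eq_natCast_iff' _ _ _).1 h
    rw [Nat.mod_eq_of_lt x.2, Nat.mod_eq_of_lt y.2] at h'
    exact Fin.ext h'
  refine ⟨fun l => E m ((l : ℕ) : ZMod N), ?_, fun t ht => ?_⟩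
  · rw [hsum fun b => ‖E m b‖]; exact hnorm
  · rw [hval t ht, ← hsum]
    refine sum_congr rfl fun l _ => ?_
    have h3 : (((l : ℕ) : ZMod N) * (t : ZMod N)) = (((l : ℕ) * t : ℤ) : ZMod N) := by
      push_cast; rfl
    rw [h3, stdAddChar_coe, uniformGrid]
    congr 2
    push_cast
    field_simp

end Interpolation

/-! ### Spectral decomposition of isometries in finite dimension -/

section Isometry

variable {V : Type*} [NormedAddCommGroup V] [InnerProductSpace ℂ V]

lemma norm_eigenvalue_eq_one (U : V →ₗᵢ[ℂ] V) {μ : ℂ} {w : V} (hw : w ≠ 0) (h : U w = μ • w) :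
    ‖μ‖ = 1 := by
  have h1 := U.norm_map w
  rw [h, norm_smul] at h1
  exact mul_right_cancel₀ (norm_ne_zero_iff.2 hw) (h1.trans (one_mul _).symm)

lemma inner_eigenvector_eq_zero (U : V →ₗᵢ[ℂ] V) {μ ν : ℂ} {w x : V} (hμν : μ ≠ ν)
    (h : U w = μ • w) (h' : U x = ν • x) : inner ℂ w x = 0 := by
  by_cases hw : w = 0
  · simp [hw]
  have h1 := U.inner_map_map w x
  rw [h, h', inner_smul_left, inner_smul_right, ← mul_assoc] at h1
  by_contra h0
  have h2 : (starRingEnd ℂ) μ * ν = 1 := mul_right_cancel₀ h0 (h1.trans (one_mul _).symm)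
  have h3 : μ * (starRingEnd ℂ) μ = 1 := by
    rw [Complex.mul_conj, Complex.normSq_eq_norm_sq, norm_eigenvalue_eq_one U hw h]; simp
  apply hμν
  calc μ = μ * ((starRingEnd ℂ) μ * ν) := by rw [h2, mul_one]
    _ = ν := by rw [← mul_assoc, h3, one_mul]

variable [FiniteDimensional ℂ V]

/-- Linear maps with equal norms pointwise differ by a linear isometry of the codomain. -/
lemma exists_linearIsometry_comp_eq {E : Type*} [AddCommGroup E] [Module ℂ E]
    (F G : E →ₗ[ℂ] V) (h : ∀ x, ‖F x‖ = ‖G x‖) :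
    ∃ U : V →ₗᵢ[ℂ] V, ∀ x, U (F x) = G x := by
  have hker : LinearMap.ker F ≤ LinearMap.ker G := fun x hx => by
    rw [LinearMap.mem_ker] at hx ⊢
    rw [← norm_eq_zero, ← h, hx, norm_zero]
  let L₀ : LinearMap.range F →ₗ[ℂ] V :=
    (LinearMap.ker F).liftQ G hker ∘ₗ F.quotKerEquivRange.symm.toLinearMap
  have hL₀ : ∀ x, L₀ ⟨F x, LinearMap.mem_range_self F x⟩ = G x := fun x => by
    have : F.quotKerEquivRange.symm ⟨F x, LinearMap.mem_range_self F x⟩ =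
        Submodule.Quotient.mk x := by
      rw [LinearEquiv.symm_apply_eq]; rfl
    simp only [L₀, LinearMap.comp_apply, LinearEquiv.coe_coe, this]
    rfl
  let L : LinearMap.range F →ₗᵢ[ℂ] V := ⟨L₀, by
    rintro ⟨_, x, rfl⟩
    rw [hL₀, ← h]; rfl⟩
  exact ⟨L.extend, fun x => (L.extend_apply ⟨F x, LinearMap.mem_range_self F x⟩).trans (hL₀ x)⟩

/-- The orthogonal complement of all eigenvectors is `U`-invariant, because `U` preserves inner
products and its eigenvalues are nonzero. If it were nontrivial it would contain an eigenvector,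
which would be orthogonal to itself. -/
lemma iSup_eigenspace_linearIsometry (U : V →ₗᵢ[ℂ] V) :
    ⨆ μ, Module.End.eigenspace U.toLinearMap μ = ⊤ := by
  set W := ⨆ μ, Module.End.eigenspace U.toLinearMap μ with hW
  have hmem : ∀ x, x ∈ Wᗮ ↔ ∀ (μ : ℂ) (w : V), U w = μ • w → inner ℂ w x = 0 := by
    intro x
    rw [hW, ← Submodule.iInf_orthogonal, Submodule.mem_iInf]
    refine forall_congr' fun μ => ?_
    rw [Submodule.mem_orthogonal]
    simp
  have hinv : ∀ x ∈ Wᗮ, U.toLinearMap x ∈ Wᗮ := by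
    intro x hx
    rw [hmem] at hx ⊢
    intro μ w hw
    by_cases hw0 : w = 0
    · simp [hw0]
    have h1 : inner ℂ (U w) (U x) = 0 := by rw [U.inner_map_map]; exact hx μ w hw
    rw [hw, inner_smul_left] at h1
    refine (mul_eq_zero.1 h1).resolve_left fun h => ?_
    have := norm_eigenvalue_eq_one U hw0 hw
    rw [map_eq_zero] at h
    simp [h] at this
  rw [← Submodule.orthogonal_eq_bot_iff]
  by_contra hne
  have := Submodule.nontrivial_iff_ne_bot.2 hne
  obtain ⟨c, hc⟩ := Module.End.exists_eigenvalue (U.toLinearMap.restrict hinv)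
  obtain ⟨x, hx⟩ := hc.exists_hasEigenvector
  have h1 : U (x : V) = c • (x : V) := congrArg Subtype.val hx.apply_eq_smul
  have h2 := (hmem x).1 x.2 c x h1
  exact hx.2 (Subtype.ext (inner_self_eq_zero.1 h2))

/-- The correlations of the orbit of a vector under an isometry are those of finitely many
sinusoids. -/
lemma exists_inner_pow_eq_sum (U : V →ₗᵢ[ℂ] V) (v : V) :
    ∃ (K : ℕ) (f p : Fin K → ℝ), (∀ l, 0 ≤ p l) ∧ ∀ j k : ℕ,
      inner ℂ (U^[j] v) (U^[k] v) = ∑ l, (p l : ℂ) *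
        (Complex.exp (2 * (Real.pi : ℂ) * Complex.I * (j : ℂ) * (f l : ℂ)) *
          star (Complex.exp (2 * (Real.pi : ℂ) * Complex.I * (k : ℂ) * (f l : ℂ)))) := by
  have hv : v ∈ ⨆ μ, Module.End.eigenspace U.toLinearMap μ := by
    rw [iSup_eigenspace_linearIsometry]; trivial
  obtain ⟨w, hw, hsum⟩ := (Submodule.mem_iSup_iff_exists_finsupp _ _).1 hv
  have hU : ∀ μ, U (w μ) = μ • w μ := fun μ => Module.End.mem_eigenspace_iff.1 (hw μ)
  have hpow : ∀ (j : ℕ), U^[j] v = ∑ μ ∈ w.support, μ ^ j • w μ := by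
    intro j
    induction j with
    | zero => simpa [Finsupp.sum] using hsum.symm
    | succ n ih =>
      rw [Function.iterate_succ_apply', ih, map_sum]
      refine sum_congr rfl fun μ _ => ?_
      rw [map_smul, hU, smul_smul, pow_succ]
  -- The inner product is conjugate linear in its first argument, so index `j` contributes `conj μ ^
  -- j`; hence the minus sign in the frequency `-arg μ / (2π)`.
  have hfreq : ∀ μ ∈ w.support, ∀ j : ℕ, (starRingEnd ℂ) μ ^ j =
      Complex.exp (2 * (Real.pi : ℂ) * Complex.I * (j : ℂ) *
        ((-μ.arg / (2 * Real.pi) : ℝ) : ℂ)) := by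
    intro μ hμ j
    have h1 := norm_eigenvalue_eq_one U (Finsupp.mem_support_iff.1 hμ) (hU μ)
    have h2 : μ = Complex.exp (μ.arg * Complex.I) := by
      conv_lhs => rw [← Complex.norm_mul_exp_arg_mul_I μ, h1]
      simp
    have h3 : (starRingEnd ℂ) μ = Complex.exp (-(μ.arg * Complex.I)) := by
      conv_lhs => rw [h2, ← Complex.exp_conj]
      simp
    rw [h3, ← Complex.exp_nat_mul]
    congr 1
    have := Real.pi_pos.ne'
    push_cast
    field_simp
  have key : ∀ j k : ℕ, inner ℂ (U^[j] v) (U^[k] v) =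
      ∑ μ ∈ w.support, ((‖w μ‖ ^ 2 : ℝ) : ℂ) *
        (Complex.exp (2 * (Real.pi : ℂ) * Complex.I * (j : ℂ) *
            ((-μ.arg / (2 * Real.pi) : ℝ) : ℂ)) *
          star (Complex.exp (2 * (Real.pi : ℂ) * Complex.I * (k : ℂ) *
            ((-μ.arg / (2 * Real.pi) : ℝ) : ℂ)))) := by
    intro j k
    rw [hpow, hpow, sum_inner]
    refine sum_congr rfl fun μ hμ => ?_
    rw [inner_sum, Finset.sum_eq_single μ]
    · rw [inner_smul_left, inner_smul_right, inner_self_eq_norm_sq_to_K, ← hfreq μ hμ,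
        ← hfreq μ hμ]
      simp
      ring
    · intro ν _ hν
      rw [inner_smul_left, inner_smul_right, inner_eigenvector_eq_zero U hν.symm (hU μ) (hU ν)]
      simp
    · exact fun h => absurd hμ h
  refine ⟨w.support.card, fun l => -(w.support.equivFin.symm l : ℂ).arg / (2 * Real.pi),
    fun l => ‖w (w.support.equivFin.symm l)‖ ^ 2, fun l => by positivity, fun j k => ?_⟩
  rw [key, ← Finset.sum_coe_sort]
  exact (w.support.equivFin.symm.sum_comp _).symm

end Isometry

/-! ### Carathéodory–Fejér decomposition -/

open scoped MatrixOrder Matrix.Norms.L2Operator in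
lemma exists_eq_conjTranspose_mul_self {ι : Type*} [Fintype ι] [DecidableEq ι]
    {A : Matrix ι ι ℂ} (h : A.PosSemidef) : ∃ B : Matrix ι ι ℂ, A = B.conjTranspose * B :=
  CStarAlgebra.nonneg_iff_eq_star_mul_self.1 h.nonneg

/-- **Carathéodory–Fejér**: a positive semidefinite Toeplitz matrix is the covariance matrix of
finitely many uncorrelated sinusoids. -/
lemma exists_toeplitz_eq_sum {M : ℕ} (u : Fin M → ℂ) (hu : (toeplitz u).PosSemidef) :
    ∃ (K : ℕ) (f p : Fin K → ℝ), (∀ l, 0 ≤ p l) ∧ ∀ j k : Fin M,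
      toeplitz u j k = ∑ l, (p l : ℂ) *
        (Complex.exp (2 * (Real.pi : ℂ) * Complex.I * ((j : ℕ) : ℂ) * (f l : ℂ)) *
          star (Complex.exp (2 * (Real.pi : ℂ) * Complex.I * ((k : ℕ) : ℂ) * (f l : ℂ)))) := by
  obtain _ | n := M
  · exact ⟨0, 0, 0, fun l => l.elim0, fun j => j.elim0⟩
  obtain ⟨B, hB⟩ := exists_eq_conjTranspose_mul_self hu
  let v : Fin (n + 1) → EuclideanSpace ℂ (Fin (n + 1)) := fun j => WithLp.toLp 2 fun i => B i j
  have hv : ∀ j k, inner ℂ (v j) (v k) = toeplitz u j k := by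
    intro j k
    rw [hB, Matrix.mul_apply, PiLp.inner_apply]
    refine sum_congr rfl fun i _ => ?_
    simp [v, mul_comm]
  let F : (Fin n → ℂ) →ₗ[ℂ] EuclideanSpace ℂ (Fin (n + 1)) :=
    Fintype.linearCombination ℂ fun i : Fin n => v i.castSucc
  let G : (Fin n → ℂ) →ₗ[ℂ] EuclideanSpace ℂ (Fin (n + 1)) :=
    Fintype.linearCombination ℂ fun i : Fin n => v i.succ
  -- Constancy along diagonals says that the shift `v i ↦ v (i + 1)` preserves the Gram matrix. It
  -- therefore extends to an isometry, and the columns form an orbit.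
  have hshift : ∀ i k : Fin n, inner ℂ (v i.castSucc) (v k.castSucc) =
      inner ℂ (v i.succ) (v k.succ) := by
    intro i k
    rw [hv, hv]
    simp [toeplitz]
  have hnorm : ∀ x, ‖F x‖ = ‖G x‖ := by
    intro x
    rw [← sq_eq_sq₀ (norm_nonneg _) (norm_nonneg _), ← Complex.ofReal_inj]
    push_cast
    have h1 := inner_self_eq_norm_sq_to_K (𝕜 := ℂ) (F x)
    have h2 := inner_self_eq_norm_sq_to_K (𝕜 := ℂ) (G x)
    refine h1.symm.trans (Eq.trans ?_ h2)
    simp only [F, G, Fintype.linearCombination_apply, sum_inner, inner_sum, inner_smul_left,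
      inner_smul_right, hshift]
  obtain ⟨U, hU⟩ := exists_linearIsometry_comp_eq F G hnorm
  have hstep : ∀ i : Fin n, U (v i.castSucc) = v i.succ := by
    intro i
    have := hU (Pi.single i 1)
    simpa [F, G, Fintype.linearCombination_apply_single] using this
  have horbit : ∀ j : Fin (n + 1), v j = U^[(j : ℕ)] (v 0) := by
    intro j
    induction j using Fin.induction with
    | zero => rfl
    | succ i ih =>
      rw [← hstep, ih, Fin.val_succ, Function.iterate_succ_apply']; rfl
  obtain ⟨K, f, p, hp, h⟩ := exists_inner_pow_eq_sum U (v 0)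
  refine ⟨K, f, p, hp, fun j k => ?_⟩
  rw [← hv, horbit j, horbit k, h]

/-! ### Monotonicity and finiteness of the fitting objective -/

section Objective

variable {ι : Type*}

lemma nonneg_of_posSemidef_bordered {x : ℝ} {y : ι → ℂ} {R : Matrix ι ι ℂ}
    (h : (bordered x y R).PosSemidef) : 0 ≤ x := by
  have := h.diag_nonneg (i := Sum.inl ())
  simpa [bordered] using this

lemma invQuadForm_nonneg (R : Matrix ι ι ℂ) (y : ι → ℂ) : 0 ≤ invQuadForm R y :=
  le_iInf₂ fun _ hx => EReal.coe_nonneg.2 (nonneg_of_posSemidef_bordered hx)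

variable [Fintype ι]

/-- Congruence by `diag (C, 1)` turns the blocks `x, y, R` into `C² x, C y, R`. Adding `C R' - R` to
the last block and dividing by `C` gives `C x, y, R'`. No inverse is needed, so singular matrices
are covered. -/
lemma posSemidef_bordered_of_le [DecidableEq ι] {x C : ℝ} (hC : 0 < C) {y : ι → ℂ}
    {R R' : Matrix ι ι ℂ}
    (hR : ((C : ℂ) • R' - R).PosSemidef) (h : (bordered x y R).PosSemidef) :
    (bordered (C * x) y R').PosSemidef := by
  let D : Matrix (Unit ⊕ ι) (Unit ⊕ ι) ℂ := Matrix.fromBlocks (Matrix.diagonal fun _ => (C : ℂ)) 0 0 1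
  let B : Matrix ι (Unit ⊕ ι) ℂ := Matrix.fromCols 0 1
  have h1 : bordered (C * x) y R' = ((C⁻¹ : ℝ) : ℂ) •
      (D.conjTranspose * bordered x y R * D +
        B.conjTranspose * ((C : ℂ) • R' - R) * B) := by
    have hC' : (C : ℂ) ≠ 0 := Complex.ofReal_ne_zero.2 hC.ne'
    ext (i | i) (j | j) <;>
    simp [D, B, bordered, Matrix.fromBlocks_conjTranspose, Matrix.fromBlocks_multiply,
      Matrix.conjTranspose_fromCols_eq_fromRows_conjTranspose, Matrix.fromRows_mul,
      Matrix.mul_fromCols] <;> field_simp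
  rw [h1]
  exact ((h.conjTranspose_mul_mul_same D).add (hR.conjTranspose_mul_mul_same B)).smul
    (Complex.zero_le_real.2 (inv_nonneg.2 hC.le))

lemma invQuadForm_le_of_le {C : ℝ} (hC : 0 < C) {R R' : Matrix ι ι ℂ}
    (hR : ((C : ℂ) • R' - R).PosSemidef) (y : ι → ℂ) :
    invQuadForm R' y ≤ C * invQuadForm R y := by
  classical
  rw [← EReal.div_le_iff_le_mul (EReal.coe_pos.2 hC) (EReal.coe_ne_top C)]
  refine le_iInf₂ fun x hx => ?_
  rw [EReal.div_le_iff_le_mul (EReal.coe_pos.2 hC) (EReal.coe_ne_top C), ← EReal.coe_mul]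
  exact iInf₂_le (f := fun (x : ℝ) (_ : (bordered x y R').PosSemidef) => (x : EReal)) (C * x)
    (posSemidef_bordered_of_le hC hR hx)

lemma wcfObjective_le_of_le {C : ℝ} (hC : 0 < C) {R R' : Matrix ι ι ℂ}
    (hR : ((C : ℂ) • R' - R).PosSemidef) (htr : R'.trace.re ≤ C * R.trace.re) (y : ι → ℂ) :
    wcfObjective R' y ≤ C * wcfObjective R y := by
  have hy : (0 : EReal) ≤ ((∑ j, ‖y j‖ ^ 2 : ℝ) : EReal) :=
    EReal.coe_nonneg.2 (sum_nonneg fun _ _ => by positivity)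
  unfold wcfObjective
  rw [EReal.left_distrib_of_nonneg_of_ne_top (EReal.coe_nonneg.2 hC.le) (EReal.coe_ne_top C),
    mul_left_comm]
  refine add_le_add ?_ (mul_le_mul_of_nonneg_left (invQuadForm_le_of_le hC hR y) hy)
  rw [← EReal.coe_mul]
  exact EReal.coe_le_coe_iff.2 htr

lemma wcfObjective_nonneg {R : Matrix ι ι ℂ} (hR : R.PosSemidef) (y : ι → ℂ) :
    0 ≤ wcfObjective R y := by
  refine add_nonneg (EReal.coe_nonneg.2 ?_) (mul_nonneg (EReal.coe_nonneg.2
    (sum_nonneg fun _ _ => by positivity)) (invQuadForm_nonneg R y))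
  exact (Complex.le_def.1 hR.trace_nonneg).1

lemma wcfObjective_noiseCov_const_lt_top [DecidableEq ι] {s : ℝ} (hs : 0 < s) (y : ι → ℂ) :
    wcfObjective (noiseCov fun _ : ι => s) y < ⊤ := by
  let x : ℝ := s⁻¹ * ∑ j, ‖y j‖ ^ 2
  have hx : (bordered x y (noiseCov fun _ : ι => s)).PosSemidef := by
    -- With rows `yᴴ` and `s I`, the product `B Bᴴ` has blocks `‖y‖²`, `s y`, `s² I`, which is `s`
    -- times the bordered matrix.
    let B : Matrix (Unit ⊕ ι) ι ℂ :=
      Matrix.fromRows (Matrix.replicateRow Unit (star y)) (Matrix.diagonal fun _ => (s : ℂ))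
    have h1 : bordered x y (noiseCov fun _ : ι => s) =
        ((s⁻¹ : ℝ) : ℂ) • (B * B.conjTranspose) := by
      have hs' : (s : ℂ) ≠ 0 := Complex.ofReal_ne_zero.2 hs.ne'
      ext (i | i) (j | j)
      · simp [B, x, bordered, Matrix.mul_apply, Complex.conj_mul']
      · simp [B, bordered, Matrix.mul_apply, Matrix.diagonal_apply, apply_ite (starRingEnd ℂ)]
        field_simp
      · simp [B, bordered, Matrix.mul_apply, Matrix.diagonal_apply, hs']
      · rcases eq_or_ne i j with rfl | hij
        · simp [B, bordered, noiseCov, Matrix.mul_apply, Matrix.diagonal_apply, hs']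
        · simp [B, bordered, noiseCov, Matrix.mul_apply, Matrix.diagonal_apply, hij, hij.symm]
    rw [h1]
    exact (Matrix.posSemidef_self_mul_conjTranspose B).smul
      (Complex.zero_le_real.2 (inv_nonneg.2 hs.le))
  have hq : invQuadForm (noiseCov fun _ : ι => s) y ≤ (x : EReal) := iInf₂_le x hx
  refine lt_of_le_of_lt (add_le_add le_rfl (mul_le_mul_of_nonneg_left hq
    (EReal.coe_nonneg.2 (sum_nonneg fun _ _ => by positivity)))) ?_
  rw [← EReal.coe_mul, ← EReal.coe_add]
  exact EReal.coe_lt_top _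

end Objective

/-! ### The two properties of the noise models that are used -/

section NoiseModel

lemma NoiseModel.nonneg_of_mem_variances {ι : Type*} {noise : NoiseModel} {σ : ι → ℝ}
    (h : σ ∈ noise.variances ι) (j : ι) : 0 ≤ σ j := by
  cases noise with
  | heteroscedastic => exact h j
  | homoscedastic => obtain ⟨s, hs, h⟩ := h; rw [h]; exact hs
  | homoscedasticKnown σ₀ hσ₀ => rw [show σ j = σ₀ from h j]; exact hσ₀.le

lemma NoiseModel.exists_const_mem_variances (ι : Type*) (noise : NoiseModel) :
    ∃ s : ℝ, 0 < s ∧ (fun _ => s) ∈ noise.variances ι := by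
  cases noise with
  | heteroscedastic => exact ⟨1, one_pos, fun _ => zero_le_one⟩
  | homoscedastic => exact ⟨1, one_pos, 1, zero_le_one, fun _ => rfl⟩
  | homoscedasticKnown σ₀ hσ₀ => exact ⟨σ₀, hσ₀, fun _ => rfl⟩

end NoiseModel

/-! ### Covariances of sinusoids: trace, quadratic form, Toeplitz structure -/

section Covariance

variable {M : ℕ} (Ω : Finset (Fin M)) {K : ℕ} (f p : Fin K → ℝ) (σ : Ω → ℝ)

lemma posSemidef_diagonal_ofReal {κ : Type*} [DecidableEq κ] {p : κ → ℝ} (hp : ∀ l, 0 ≤ p l) :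
    (Matrix.diagonal fun l => (p l : ℂ)).PosSemidef :=
  Matrix.PosSemidef.diagonal fun l => Complex.zero_le_real.2 (hp l)

lemma mul_diagonal_mul_conjTranspose_apply {ι : Type*} (A : Matrix ι (Fin K) ℂ) (j k : ι) :
    (A * Matrix.diagonal (fun l => (p l : ℂ)) * A.conjTranspose) j k =
      ∑ l, (p l : ℂ) * (A j l * star (A k l)) := by
  rw [Matrix.mul_apply]
  refine sum_congr rfl fun l _ => ?_
  rw [Matrix.mul_diagonal, Matrix.conjTranspose_apply]
  ring

variable {f p σ} in
lemma posSemidef_sinusoidCov (hp : ∀ l, 0 ≤ p l) (hσ : ∀ j, 0 ≤ σ j) :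
    (sinusoidCov Ω f p σ).PosSemidef :=
  ((posSemidef_diagonal_ofReal hp).mul_mul_conjTranspose_same _).add
    (posSemidef_diagonal_ofReal hσ)

lemma trace_re_sinusoidCov :
    (sinusoidCov Ω f p σ).trace.re = (Ω.card : ℝ) * ∑ l, p l + ∑ j, σ j := by
  have h1 : ∀ (j : Ω) l, steering Ω f j l * star (steering Ω f j l) = 1 := by
    intro j l
    rw [← starRingEnd_apply, Complex.mul_conj, Complex.normSq_eq_norm_sq]
    have : ‖steering Ω f j l‖ = 1 := by
      simp [steering, Complex.norm_exp]
    rw [this]; simp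
  have h2 : (sinusoidCov Ω f p σ).trace =
      (((Ω.card : ℝ) * ∑ l, p l + ∑ j, σ j : ℝ) : ℂ) := by
    rw [sinusoidCov, Matrix.trace_add, noiseCov, Matrix.trace_diagonal, Matrix.trace]
    simp only [Matrix.diag_apply, mul_diagonal_mul_conjTranspose_apply, h1]
    simp
  rw [h2, Complex.ofReal_re]

lemma star_dotProduct_sinusoidCov_mulVec (w : Ω → ℂ) :
    star w ⬝ᵥ (sinusoidCov Ω f p σ).mulVec w =
      ((∑ l, p l * ‖∑ j, star (w j) * steering Ω f j l‖ ^ 2 + ∑ j, σ j * ‖w j‖ ^ 2 : ℝ) : ℂ) := by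
  rw [sinusoidCov, Matrix.add_mulVec, dotProduct_add, Complex.ofReal_add]
  congr 1
  · rw [← Matrix.mulVec_mulVec, ← Matrix.mulVec_mulVec, Matrix.dotProduct_mulVec]
    simp only [dotProduct, Matrix.mulVec_diagonal]
    push_cast
    refine sum_congr rfl fun l _ => ?_
    have h1 : (steering Ω f).conjTranspose.mulVec w l =
        (starRingEnd ℂ) (Matrix.vecMul (star w) (steering Ω f) l) := by
      simp [Matrix.mulVec, Matrix.vecMul, dotProduct, mul_comm]
    have h2 : ∑ j, star (w j) * steering Ω f j l = Matrix.vecMul (star w) (steering Ω f) l := by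
      simp [Matrix.vecMul, dotProduct]
    rw [h1, h2, ← Complex.mul_conj']
    ring
  · simp only [noiseCov, dotProduct, Matrix.mulVec_diagonal]
    push_cast
    refine sum_congr rfl fun j _ => ?_
    rw [← Complex.mul_conj', Pi.star_apply, ← starRingEnd_apply]
    ring

variable {Ω f p} in
lemma toeplitzCov_eq_sinusoidCov {u : Fin M → ℂ}
    (h : ∀ j k : Fin M, toeplitz u j k = ∑ l, (p l : ℂ) *
        (Complex.exp (2 * (Real.pi : ℂ) * Complex.I * ((j : ℕ) : ℂ) * (f l : ℂ)) *
          star (Complex.exp (2 * (Real.pi : ℂ) * Complex.I * ((k : ℕ) : ℂ) * (f l : ℂ))))) :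
    toeplitzCov Ω u σ = sinusoidCov Ω f p σ := by
  unfold toeplitzCov sinusoidCov
  congr 1
  ext j k
  rw [Matrix.submatrix_apply, h, mul_diagonal_mul_conjTranspose_apply]
  rfl

variable {p} in
lemma exists_posSemidef_toeplitz (hp : ∀ l, 0 ≤ p l) :
    ∃ u : Fin M → ℂ, (toeplitz u).PosSemidef ∧ toeplitzCov Ω u σ = sinusoidCov Ω f p σ := by
  let u : Fin M → ℂ := fun d => ∑ l, (p l : ℂ) *
    star (Complex.exp (2 * (Real.pi : ℂ) * Complex.I * ((d : ℕ) : ℂ) * (f l : ℂ)))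
  have hu : ∀ j k : Fin M, toeplitz u j k = ∑ l, (p l : ℂ) *
        (Complex.exp (2 * (Real.pi : ℂ) * Complex.I * ((j : ℕ) : ℂ) * (f l : ℂ)) *
          star (Complex.exp (2 * (Real.pi : ℂ) * Complex.I * ((k : ℕ) : ℂ) * (f l : ℂ)))) := by
    intro j k
    have hconj : ∀ (t : ℕ) (x : ℝ),
        star (Complex.exp (2 * (Real.pi : ℂ) * Complex.I * (t : ℂ) * (x : ℂ))) =
          Complex.exp (-(2 * (Real.pi : ℂ) * Complex.I * (t : ℂ) * (x : ℂ))) := by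
      intro t x
      rw [← starRingEnd_apply, ← Complex.exp_conj]
      simp [map_ofNat]
    rw [toeplitz, Matrix.of_apply]
    split_ifs with hjk
    · refine sum_congr rfl fun l _ => ?_
      rw [hconj, hconj, ← Complex.exp_add]
      congr 2
      rw [Nat.cast_sub (Fin.le_def.1 hjk)]
      ring
    · simp only [u, star_sum, star_mul', star_star]
      refine sum_congr rfl fun l _ => ?_
      rw [hconj, ← Complex.exp_add, ← starRingEnd_apply, Complex.conj_ofReal]
      congr 2
      rw [Nat.cast_sub (Fin.le_def.1 (le_of_not_ge hjk))]
      ring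
  refine ⟨u, ?_, toeplitzCov_eq_sinusoidCov σ hu⟩
  let A : Matrix (Fin M) (Fin K) ℂ := Matrix.of fun j l =>
    Complex.exp (2 * (Real.pi : ℂ) * Complex.I * ((j : ℕ) : ℂ) * (f l : ℂ))
  have : toeplitz u = A * Matrix.diagonal (fun l => (p l : ℂ)) * A.conjTranspose := by
    ext j k
    rw [hu, mul_diagonal_mul_conjTranspose_apply]
    rfl
  rw [this]
  exact (posSemidef_diagonal_ofReal hp).mul_mul_conjTranspose_same _

end Covariance

/-! ### Moving the frequencies to the grid -/

section Grid

variable {M : ℕ} (Ω : Finset (Fin M)) (hΩ : Ω.Nonempty)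

lemma exists_steering_grid_coefficients {N : ℕ} [NeZero N]
    (hN : 2 * (samplingRange Ω hΩ - 1) ≤ N) {K : ℕ} (f : Fin K → ℝ) (k : Fin K) :
    ∃ c : Fin N → ℂ,
      ∑ l, ‖c l‖ ≤ Real.exp (Real.pi * (samplingRange Ω hΩ - 1 : ℕ) / N) ∧
      ∀ j : Ω, steering Ω f j k = ∑ l, c l * steering Ω (uniformGrid N) j l := by
  obtain ⟨c, hc, h⟩ := exists_grid_coefficients _ hN (f k)
  set m : ℕ := (Ω.min' hΩ : ℕ) with hm
  have hnorm : ∀ x : ℝ, ‖Complex.exp (2 * (Real.pi : ℂ) * Complex.I * (m : ℂ) * (x : ℂ))‖ = 1 := by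
    intro x; simp [Complex.norm_exp]
  -- Shifting time so that the first sample is at `0` costs only unimodular factors. This is why the
  -- bound involves the sampling range and not `M`.
  refine ⟨fun l => c l * (Complex.exp (2 * (Real.pi : ℂ) * Complex.I * (m : ℂ) * (f k : ℂ)) *
    (Complex.exp (2 * (Real.pi : ℂ) * Complex.I * (m : ℂ) * (uniformGrid N l : ℂ)))⁻¹), ?_,
    fun j => ?_⟩
  · simpa [hnorm] using hc
  · have h1 : m ≤ (j : Fin M).val := Fin.le_def.1 (Ω.min'_le _ j.2)
    have h2 : (j : Fin M).val ≤ (Ω.max' hΩ).val := Fin.le_def.1 (Ω.le_max' _ j.2)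
    have h3 := h ((j : Fin M).val - m) (by unfold samplingRange; omega)
    have h4 : ∀ x : ℝ,
        Complex.exp (2 * (Real.pi : ℂ) * Complex.I * ((j : Fin M).val : ℂ) * (x : ℂ)) =
        Complex.exp (2 * (Real.pi : ℂ) * Complex.I * (m : ℂ) * (x : ℂ)) *
        Complex.exp (2 * (Real.pi : ℂ) * Complex.I * (((j : Fin M).val - m : ℕ) : ℂ) *
          (x : ℂ)) := by
      intro x
      rw [← Complex.exp_add, Nat.cast_sub h1]
      congr 1; ring
    simp only [steering, Matrix.of_apply]
    rw [h4, h3, mul_sum]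
    refine sum_congr rfl fun l _ => ?_
    rw [h4]
    have := Complex.exp_ne_zero
      (2 * (Real.pi : ℂ) * Complex.I * (m : ℂ) * (uniformGrid N l : ℂ))
    field_simp

/-- Cauchy–Schwarz with weights `‖c l‖`. Applied to quadratic forms, it bounds the rank-one matrix
of `∑ c_l a_l` by `‖c‖₁ ∑ |c_l| a_l a_lᴴ`. -/
lemma norm_sum_mul_sq_le {κ : Type*} (s : Finset κ) (c b : κ → ℂ) :
    ‖∑ l ∈ s, c l * b l‖ ^ 2 ≤ (∑ l ∈ s, ‖c l‖) * ∑ l ∈ s, ‖c l‖ * ‖b l‖ ^ 2 := by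
  have h1 : ‖∑ l ∈ s, c l * b l‖ ≤ ∑ l ∈ s, ‖c l‖ * ‖b l‖ :=
    (norm_sum_le _ _).trans (le_of_eq (sum_congr rfl fun l _ => norm_mul _ _))
  refine (pow_le_pow_left₀ (norm_nonneg _) h1 2).trans ?_
  refine sum_sq_le_sum_mul_sum_of_sq_le_mul s (fun _ _ => norm_nonneg _)
    (fun _ _ => by positivity) fun l _ => le_of_eq (by ring)

/-- Moving the frequencies to the grid increases the objective by a factor of at most
`exp (π (M̄ - 1) / N)`. -/
lemma exists_grid_wcfObjective_le {N : ℕ} [NeZero N] (hN : 2 * (samplingRange Ω hΩ - 1) ≤ N)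
    {K : ℕ} (f p : Fin K → ℝ) (hp : ∀ l, 0 ≤ p l) (σ : Ω → ℝ) (hσ : ∀ j, 0 ≤ σ j) (y : Ω → ℂ) :
    ∃ q : Fin N → ℝ, (∀ l, 0 ≤ q l) ∧
      wcfObjective (sinusoidCov Ω (uniformGrid N) q σ) y ≤
        (Real.exp (Real.pi * (samplingRange Ω hΩ - 1 : ℕ) / N) : ℝ) *
          wcfObjective (sinusoidCov Ω f p σ) y := by
  choose c hc hsteer using exists_steering_grid_coefficients Ω hΩ hN f
  set C := Real.exp (Real.pi * (samplingRange Ω hΩ - 1 : ℕ) / N) with hCdef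
  have hC1 : 1 ≤ C := Real.one_le_exp (by have := Real.pi_pos; positivity)
  have hC0 : 0 < C := by linarith
  have hq : ∀ l, 0 ≤ ∑ k, p k * ‖c k l‖ := fun l =>
    sum_nonneg fun k _ => mul_nonneg (hp k) (norm_nonneg _)
  refine ⟨fun l => ∑ k, p k * ‖c k l‖, hq, wcfObjective_le_of_le hC0 ?_ ?_ y⟩
  · refine .of_dotProduct_mulVec_nonneg ?_ fun w => ?_
    · exact ((posSemidef_sinusoidCov Ω hq hσ).smul
        (Complex.zero_le_real.2 hC0.le)).isHermitian.sub
        (posSemidef_sinusoidCov Ω hp hσ).isHermitian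
    · rw [Matrix.sub_mulVec, Matrix.smul_mulVec, dotProduct_sub, dotProduct_smul,
        star_dotProduct_sinusoidCov_mulVec, star_dotProduct_sinusoidCov_mulVec, smul_eq_mul,
        ← Complex.ofReal_mul, ← Complex.ofReal_sub, Complex.zero_le_real, sub_nonneg, mul_add]
      set b : Fin N → ℂ := fun l => ∑ j, star (w j) * steering Ω (uniformGrid N) j l with hb
      have hexp : ∀ k, ∑ j, star (w j) * steering Ω f j k = ∑ l, c k l * b l := by
        intro k
        simp_rw [hsteer, hb, mul_sum]
        rw [sum_comm]
        exact sum_congr rfl fun l _ => sum_congr rfl fun j _ => by ring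
      -- The noise variances are left unchanged, so every noise model stays feasible; their terms
      -- only need `1 ≤ C`.
      refine add_le_add ?_ (le_mul_of_one_le_left
        (sum_nonneg fun j _ => mul_nonneg (hσ j) (by positivity)) hC1)
      calc ∑ k, p k * ‖∑ j, star (w j) * steering Ω f j k‖ ^ 2
          ≤ ∑ k, p k * (C * ∑ l, ‖c k l‖ * ‖b l‖ ^ 2) := by
            refine sum_le_sum fun k _ => mul_le_mul_of_nonneg_left ?_ (hp k)
            rw [hexp]
            refine (norm_sum_mul_sq_le _ _ _).trans ?_
            exact mul_le_mul_of_nonneg_right (hc k) (sum_nonneg fun _ _ => by positivity)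
        _ = C * ∑ l, (∑ k, p k * ‖c k l‖) * ‖b l‖ ^ 2 := by
            simp_rw [sum_mul, mul_sum]
            rw [sum_comm]
            exact sum_congr rfl fun l _ => sum_congr rfl fun k _ => by ring
  · rw [trace_re_sinusoidCov, trace_re_sinusoidCov, mul_add]
    refine add_le_add ?_ (le_mul_of_one_le_left (sum_nonneg fun j _ => hσ j) hC1)
    rw [mul_left_comm]
    refine mul_le_mul_of_nonneg_left ?_ (Nat.cast_nonneg _)
    rw [sum_comm, mul_sum]
    refine sum_le_sum fun k _ => ?_
    rw [← mul_sum, mul_comm C]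
    exact mul_le_mul_of_nonneg_left (hc k) (hp k)

end Grid

/-! ### Comparison of the optimal values -/

section OptimalValues

variable {M : ℕ} (Ω : Finset (Fin M)) (noise : NoiseModel) (y : Ω → ℂ)

lemma glsOpt_le_spiceOpt (N : ℕ) : glsOpt Ω noise y ≤ spiceOpt Ω noise y N := by
  refine le_iInf₂ fun p hp => le_iInf₂ fun σ hσ => ?_
  obtain ⟨u, hu, h⟩ := exists_posSemidef_toeplitz Ω (uniformGrid N) σ hp
  rw [← h]
  exact (iInf₂_le u hu).trans (iInf₂_le σ hσ)

lemma glsOpt_nonneg : 0 ≤ glsOpt Ω noise y := by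
  refine le_iInf₂ fun u hu => le_iInf₂ fun σ hσ => wcfObjective_nonneg ?_ y
  exact (hu.submatrix _).add (posSemidef_diagonal_ofReal (noise.nonneg_of_mem_variances hσ))

lemma spiceOpt_lt_top (N : ℕ) : spiceOpt Ω noise y N < ⊤ := by
  obtain ⟨s, hs, hmem⟩ := noise.exists_const_mem_variances Ω
  refine lt_of_le_of_lt ((iInf₂_le (0 : Fin N → ℝ) fun _ => le_rfl).trans (iInf₂_le _ hmem)) ?_
  have : sinusoidCov Ω (uniformGrid N) 0 (fun _ => s) = noiseCov fun _ => s := by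
    simp [sinusoidCov]
  rw [this]
  exact wcfObjective_noiseCov_const_lt_top hs y

lemma spiceOpt_le_exp_mul_glsOpt (hΩ : Ω.Nonempty) {N : ℕ} [NeZero N]
    (hN : 2 * (samplingRange Ω hΩ - 1) ≤ N) :
    spiceOpt Ω noise y N ≤
      (Real.exp (Real.pi * (samplingRange Ω hΩ - 1 : ℕ) / N) : ℝ) * glsOpt Ω noise y := by
  have hC := Real.exp_pos (Real.pi * (samplingRange Ω hΩ - 1 : ℕ) / N)
  rw [← EReal.div_le_iff_le_mul (EReal.coe_pos.2 hC) (EReal.coe_ne_top _)]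
  refine le_iInf₂ fun u hu => le_iInf₂ fun σ hσ => ?_
  rw [EReal.div_le_iff_le_mul (EReal.coe_pos.2 hC) (EReal.coe_ne_top _)]
  obtain ⟨K, f, p, hp, h⟩ := exists_toeplitz_eq_sum u hu
  rw [toeplitzCov_eq_sinusoidCov σ h]
  obtain ⟨q, hq, hle⟩ := exists_grid_wcfObjective_le Ω hΩ hN f p hp σ
    (noise.nonneg_of_mem_variances hσ) y
  exact ((iInf₂_le q hq).trans (iInf₂_le σ hσ)).trans hle

end OptimalValues

end LineSpectral

end

theorem mainTheorem5 {M : ℕ} (Ω : Finset (Fin M)) (hΩ : Ω.Nonempty)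
    (noise : LineSpectral.NoiseModel) (y : Ω → ℂ) :
    ∃ (G : ℝ) (S : ℕ → ℝ),
      LineSpectral.glsOpt Ω noise y = (G : EReal) ∧
      (∀ N : ℕ, 1 ≤ N → LineSpectral.spiceOpt Ω noise y N = (S N : EReal)) ∧
      (∀ N : ℕ, 1 ≤ N →
        (1 - Real.pi * (LineSpectral.samplingRange Ω hΩ : ℝ) / (N : ℝ)) * S N ≤ G ∧ G ≤ S N) ∧
      Filter.Tendsto S Filter.atTop (nhds G) := by
  open LineSpectral in
  have hG0 := glsOpt_nonneg Ω noise y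
  have hGS := glsOpt_le_spiceOpt Ω noise y
  have hStop := spiceOpt_lt_top Ω noise y
  have hG : glsOpt Ω noise y = ((glsOpt Ω noise y).toReal : EReal) :=
    (EReal.coe_toReal ((hGS 1).trans_lt (hStop 1)).ne (ne_of_gt (EReal.bot_lt_zero.trans_le hG0))).symm
  have hS : ∀ N, spiceOpt Ω noise y N = ((spiceOpt Ω noise y N).toReal : EReal) := fun N =>
    (EReal.coe_toReal (hStop N).ne
      (ne_of_gt (EReal.bot_lt_zero.trans_le (hG0.trans (hGS N))))).symm
  set G := (glsOpt Ω noise y).toReal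
  set S : ℕ → ℝ := fun N => (spiceOpt Ω noise y N).toReal with hSdef
  have hS' : ∀ N, spiceOpt Ω noise y N = (S N : EReal) := hS
  have hGnn : 0 ≤ G := by rw [hG] at hG0; exact EReal.coe_nonneg.1 hG0
  have hle : ∀ N, G ≤ S N := fun N => by
    have := hGS N
    rw [hG, hS'] at this
    exact EReal.coe_le_coe_iff.1 this
  set r : ℕ := samplingRange Ω hΩ with hr
  have hlower : ∀ N : ℕ, 1 ≤ N → (1 - Real.pi * (r : ℝ) / (N : ℝ)) * S N ≤ G := by
    intro N hN
    have hNpos : (0 : ℝ) < N := by exact_mod_cast hN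
    -- A nonpositive factor makes the bound trivial. Otherwise `N > π r ≥ 2 r`, which is fine enough
    -- for the interpolation.
    rcases le_or_gt (1 - Real.pi * (r : ℝ) / (N : ℝ)) 0 with hneg | hpos
    · exact (mul_nonpos_of_nonpos_of_nonneg hneg (hGnn.trans (hle N))).trans hGnn
    have h1 : Real.pi * r < N := by
      rw [sub_pos, div_lt_one hNpos] at hpos
      exact hpos
    have h2 : 2 * r ≤ N := by
      have h3 : (2 : ℝ) * r ≤ N := by
        have := Real.pi_gt_three
        have : (0 : ℝ) ≤ r := Nat.cast_nonneg r
        nlinarith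
      exact_mod_cast h3
    have : NeZero N := ⟨by omega⟩
    have h3 := spiceOpt_le_exp_mul_glsOpt Ω noise y hΩ (N := N) (by omega)
    rw [hG, hS', ← EReal.coe_mul, EReal.coe_le_coe_iff] at h3
    have h4 : Real.exp (Real.pi * (r - 1 : ℕ) / N) ≤ Real.exp (Real.pi * r / N) := by
      have := Real.pi_pos
      have : ((r - 1 : ℕ) : ℝ) ≤ r := by exact_mod_cast Nat.sub_le r 1
      gcongr
    have h5 : 1 - Real.pi * r / N ≤ Real.exp (-(Real.pi * r / N)) := by
      have := Real.add_one_le_exp (-(Real.pi * r / N))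
      linarith
    calc (1 - Real.pi * (r : ℝ) / (N : ℝ)) * S N
        ≤ Real.exp (-(Real.pi * r / N)) * (Real.exp (Real.pi * r / N) * G) := by
          have := hGnn.trans (hle N)
          refine mul_le_mul h5 (h3.trans ?_) this (Real.exp_pos _).le
          exact mul_le_mul_of_nonneg_right h4 hGnn
      _ = G := by rw [← mul_assoc, ← Real.exp_add]; simp
  refine ⟨G, S, hG, fun N _ => hS' N, fun N hN => ⟨hlower N hN, hle N⟩, ?_⟩
  have hlim : Filter.Tendsto (fun N : ℕ => 1 - Real.pi * (r : ℝ) / (N : ℝ)) Filter.atTop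
      (nhds 1) := by
    simpa using (tendsto_const_div_atTop_nhds_zero_nat (Real.pi * (r : ℝ))).const_sub 1
  have hlim' : Filter.Tendsto (fun N : ℕ => G / (1 - Real.pi * (r : ℝ) / (N : ℝ))) Filter.atTop
      (nhds G) := by
    have := (tendsto_const_nhds (x := G)).div hlim one_ne_zero
    rwa [div_one] at this
  refine tendsto_of_tendsto_of_tendsto_of_le_of_le' tendsto_const_nhds hlim'
    (Filter.Eventually.of_forall hle) ?_
  filter_upwards [hlim.eventually (lt_mem_nhds zero_lt_one), Filter.eventually_ge_atTop 1]
    with N hpos hN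
  rw [le_div_iff₀ hpos, mul_comm]
  exact hlower N hN
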